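/- Let $r\ge 3$ and $m\ge 0$ be integers. An $r$-graph $G$ consists of a finite vertex set $V$ and a set $E$ of $m=|E|$ edges, which are $r$-element subsets of $V$. Its MS-index (Lagrangian) is $$\mu(G)=\max\Big\{\sum_{\{i_1,\dots,i_r\}\in E}x_{i_1}\cdots x_{i_r}\;:\; x\in\mathbb{R}^V,\ x_i\ge 0,\ \sum_{i\in V}x_i=1\Big\}$$ (with $\mu(G)=0$ if $V=\emptyset$), and $\mu_r(m)$ denotes the maximum of $\mu(G)$ over all $r$-graphs $G$ with $m$ edges (and any finite number of vertices). Let $t\ge r-1$ be the real number with $$m=\binom{t}{r}:=\frac{t(t-1)\cdots(t-r+1)}{r!}.$$ Suppose that $3\le r\le 5$ or $t\ge 4(r-1)(r-2)$. Then: 1. Every $r$-graph $G$ with $m$ edges satisfies $\mu(G)\le m\,t^{-r}$, and if $\mu(G)=m\,t^{-r}$ for some such $G$, then $t$ is an integer. 2. $\mu_r(m)=m\,t^{-r}$ if and only if $t$ is an integer. 3. If $t$ is an integer, then the complete $r$-graph on $t$ vertices has $m$ edges and its MS-index equals $\mu_r(m)$ (the principal case of the Frankl–Füredi conjecture). -/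

import Mathlib

/-- An `r`-uniform hypergraph (`r`-graph) on the vertex set `V`: a finite set of edges, each of
which is a set of exactly `r` vertices. -/
structure RGraph (V : Type*) (r : ℕ) where
  /-- The edge set. -/
  edges : Finset (Finset V)
  /-- Every edge has exactly `r` vertices. -/
  card_eq : ∀ e ∈ edges, e.card = r

namespace RGraph

/-- The polynomial form `P_G(x) = ∑_{{i₁, …, i_r} ∈ E} x_{i₁} ⋯ x_{i_r}` of an `r`-graph. -/
def polyForm {V : Type*} {r : ℕ} (G : RGraph V r) (x : V → ℝ) : ℝ :=
  ∑ e ∈ G.edges, ∏ i ∈ e, x i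

/-- The MS-index (Lagrangian) `μ(G)`: the maximum of `P_G` over the standard simplex. By
`isGreatest_msIndex` it is a maximum whenever there is a vertex; if there is no vertex, the simplex
is empty and the value is `0` by convention. -/
noncomputable def msIndex {V : Type*} [Fintype V] {r : ℕ} (G : RGraph V r) : ℝ :=
  sSup (G.polyForm '' stdSimplex ℝ V)

/-- The complete `r`-graph on `V`: all `r`-element subsets of `V` are edges. -/
def complete (V : Type*) [Fintype V] (r : ℕ) : RGraph V r where
  edges := Finset.powersetCard r Finset.univ
  card_eq := fun _ he => (Finset.mem_powersetCard.1 he).2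

/-- The set of the MS-indices of all `r`-graphs with `m` edges, on any number `n` of vertices. -/
def msIndexValues (r m : ℕ) : Set ℝ :=
  {v | ∃ (n : ℕ) (G : RGraph (Fin n) r), G.edges.card = m ∧ G.msIndex = v}

/-- `μ_r(m)`, the maximum of `μ(G)` over all `r`-graphs `G` with `m` edges. By
`isGreatest_maxMSIndex` it is a maximum whenever `r ≥ 1`. -/
noncomputable def maxMSIndex (r m : ℕ) : ℝ :=
  sSup (msIndexValues r m)

theorem isCompact_image_polyForm {V : Type*} [Fintype V] {r : ℕ} (G : RGraph V r) :
    IsCompact (G.polyForm '' stdSimplex ℝ V) := by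
  refine (isCompact_stdSimplex ℝ V).image ?_
  unfold polyForm
  fun_prop

theorem isGreatest_msIndex {V : Type*} [Fintype V] [Nonempty V] {r : ℕ} (G : RGraph V r) :
    IsGreatest (G.polyForm '' stdSimplex ℝ V) G.msIndex := by
  classical
  refine G.isCompact_image_polyForm.isGreatest_sSup (Set.Nonempty.image _ ?_)
  exact ⟨_, single_mem_stdSimplex ℝ (Classical.arbitrary V)⟩

theorem polyForm_le_msIndex {V : Type*} [Fintype V] {r : ℕ} (G : RGraph V r) {x : V → ℝ}
    (hx : x ∈ stdSimplex ℝ V) : G.polyForm x ≤ G.msIndex :=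
  le_csSup G.isCompact_image_polyForm.bddAbove ⟨x, hx, rfl⟩

theorem polyForm_nonneg {V : Type*} [Fintype V] {r : ℕ} (G : RGraph V r) {x : V → ℝ}
    (hx : x ∈ stdSimplex ℝ V) : 0 ≤ G.polyForm x :=
  Finset.sum_nonneg fun _ _ => Finset.prod_nonneg fun i _ => hx.1 i

theorem msIndex_nonneg {V : Type*} [Fintype V] {r : ℕ} (G : RGraph V r) : 0 ≤ G.msIndex := by
  refine Real.sSup_nonneg ?_
  rintro _ ⟨x, hx, rfl⟩
  exact G.polyForm_nonneg hx

/-- Every `r`-graph with `m` edges has a copy, up to isolated vertices, on any given number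
`N + 1 > r * m` of vertices, and its MS-index is no smaller. -/
theorem exists_msIndex_le {V : Type*} [Fintype V] {r m N : ℕ} (G : RGraph V r)
    (hm : G.edges.card = m) (hN : m * r ≤ N + 1) :
    ∃ H : RGraph (Fin (N + 1)) r, H.edges.card = m ∧ G.msIndex ≤ H.msIndex := by
  classical
  set U : Finset V := G.edges.biUnion id with hU
  have hUc : U.card ≤ Fintype.card (Fin (N + 1)) := by
    rw [Fintype.card_fin]
    refine le_trans ?_ hN
    rw [← hm]
    exact Finset.card_biUnion_le_card_mul _ _ _ fun e he => (G.card_eq e he).le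
  obtain ⟨g⟩ : Nonempty (U ↪ Fin (N + 1)) := by
    apply Function.Embedding.nonempty_of_card_le
    simpa using hUc
  let f : V → Fin (N + 1) := fun v => if h : v ∈ U then g ⟨v, h⟩ else 0
  have hf : Set.InjOn f U := by
    intro a ha b hb hab
    have ha' : a ∈ U := ha
    have hb' : b ∈ U := hb
    simp only [f, ha', hb', dif_pos] at hab
    simpa using g.injective hab
  have hsub : ∀ e ∈ G.edges, (e : Set V) ⊆ U := fun e he v hv =>
    Finset.mem_coe.2 (Finset.mem_biUnion.2 ⟨e, he, hv⟩)
  have hinj : Set.InjOn (fun e : Finset V => e.image f) G.edges := by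
    intro a ha b hb hab
    have h1 : f '' (a : Set V) = f '' (b : Set V) := by
      have := congrArg (fun s : Finset (Fin (N + 1)) => (s : Set (Fin (N + 1)))) hab
      simpa using this
    exact Finset.coe_injective ((hf.image_eq_image_iff (hsub a ha) (hsub b hb)).1 h1)
  let H : RGraph (Fin (N + 1)) r :=
    { edges := G.edges.image fun e => e.image f
      card_eq := by
        intro e' he'
        obtain ⟨e, he, rfl⟩ := Finset.mem_image.1 he'
        rw [Finset.card_image_of_injOn (hf.mono (hsub e he)), G.card_eq e he] }
  refine ⟨H, by rw [Finset.card_image_of_injOn hinj, hm], ?_⟩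
  refine Real.sSup_le ?_ H.msIndex_nonneg
  rintro _ ⟨x, hx, rfl⟩
  let y : Fin (N + 1) → ℝ := fun j => ∑ i with f i = j, x i
  have hy : y ∈ stdSimplex ℝ (Fin (N + 1)) := by
    refine ⟨fun j => Finset.sum_nonneg fun i _ => hx.1 i, ?_⟩
    rw [← hx.2]
    exact Finset.sum_fiberwise _ _ _
  refine le_trans ?_ (H.polyForm_le_msIndex hy)
  unfold polyForm
  rw [Finset.sum_image hinj]
  refine Finset.sum_le_sum fun e he => ?_
  rw [Finset.prod_image (hf.mono (hsub e he))]
  refine Finset.prod_le_prod (fun i _ => hx.1 i) fun i _ => ?_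
  exact Finset.single_le_sum (f := x) (fun k _ => hx.1 k) (by simp)

theorem msIndexValues_nonempty {r : ℕ} (hr : 1 ≤ r) (m : ℕ) : (msIndexValues r m).Nonempty := by
  have h : m ≤ (Finset.powersetCard r (Finset.univ : Finset (Fin (m + r)))).card := by
    rw [Finset.card_powersetCard, Finset.card_univ, Fintype.card_fin, Nat.choose_symm_add.symm]
    calc m ≤ (m + 1).choose m := by simp
      _ ≤ (m + r).choose m := Nat.choose_le_choose m (by omega)
  obtain ⟨E, hE, hc⟩ := Finset.exists_subset_card_eq h
  exact ⟨_, m + r, ⟨E, fun e he => (Finset.mem_powersetCard.1 (hE he)).2⟩, hc, rfl⟩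

theorem isGreatest_maxMSIndex {r : ℕ} (hr : 1 ≤ r) (m : ℕ) :
    IsGreatest (msIndexValues r m) (maxMSIndex r m) := by
  classical
  set S : Set ℝ := {v | ∃ G : RGraph (Fin (m * r + 1)) r, G.edges.card = m ∧ G.msIndex = v}
    with hS
  have hSsub : S ⊆ msIndexValues r m := fun v ⟨G, h⟩ => ⟨_, G, h⟩
  have hdom : ∀ v ∈ msIndexValues r m, ∃ w ∈ S, v ≤ w := by
    rintro _ ⟨n, G, hG, rfl⟩
    obtain ⟨H, hH, hle⟩ := G.exists_msIndex_le (N := m * r) hG (by omega)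
    exact ⟨_, ⟨H, hH, rfl⟩, hle⟩
  have : Finite (RGraph (Fin (m * r + 1)) r) :=
    Finite.of_injective (fun G => G.edges) fun G H h => by
      cases G; cases H; simpa using h
  have hfin : S.Finite := by
    refine (Set.finite_range fun G : RGraph (Fin (m * r + 1)) r => G.msIndex).subset ?_
    rintro _ ⟨G, _, rfl⟩
    exact ⟨G, rfl⟩
  have hne : S.Nonempty := by
    obtain ⟨v, hv⟩ := msIndexValues_nonempty hr m
    obtain ⟨w, hw, _⟩ := hdom v hv
    exact ⟨w, hw⟩
  obtain ⟨w, hw, hmax⟩ := hfin.exists_maximal hne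
  have hg : IsGreatest (msIndexValues r m) w := by
    refine ⟨hSsub hw, fun v hv => ?_⟩
    obtain ⟨u, hu, hvu⟩ := hdom v hv
    rcases le_total u w with h | h
    · exact hvu.trans h
    · exact hvu.trans (hmax hu h)
  rw [maxMSIndex, hg.csSup_eq]
  exact hg

end RGraph

/-- The generalized binomial coefficient of a real number is `t (t - 1) ⋯ (t - r + 1) / r!`. -/
theorem ringChoose_eq_prod_div (t : ℝ) (r : ℕ) :
    Ring.choose t r = (∏ i ∈ Finset.range r, (t - (i : ℝ))) / (r.factorial : ℝ) := by
  have h : (descPochhammer ℤ r).smeval t = ∏ i ∈ Finset.range r, (t - (i : ℝ)) := by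
    induction r with
    | zero => simp
    | succ k ih =>
      rw [descPochhammer_succ_right, Polynomial.smeval_mul, Polynomial.smeval_sub,
        Polynomial.smeval_X, Polynomial.smeval_natCast, pow_zero, pow_one, ih,
        Finset.prod_range_succ, nsmul_one]
  rw [Ring.choose_eq_smul, h, smul_eq_mul, div_eq_inv_mul]

/-!
Let `x` be an optimal weighting of an `r`-graph `G` with `m ≥ 1` edges, let `μ = μ(G)`, and suppose
that `μ ≥ m * t ^ (-r)`. Put `s = ∏ (x i) ^ (x i)` (`selfMean`) and `p = ∑ (x i) ^ 2`, so that
`s ≤ p` by Jensen's inequality, with equality only if the nonzero weights are equal. Two upper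
bounds for `μ` are played off against each other.

* Choose a random edge with probability proportional to its weight. By the Lagrange condition it
  contains the vertex `i` with probability `r * x i`, so its entropy is `log μ - r * log s`. As the
  entropy is at most `log m`, we get `μ ≤ m * s ^ r` (`msIndex_le_card_mul_selfMean_pow`), and hence
  `s ≥ 1 / t`.
* The number `μ` is at most the elementary symmetric function of degree `r` of `x`, for which
  `r! * e_r(x) ≤ ∏ j < r, (1 - j * s) - κ * (p - s)` with some `κ > 0` (`EntropyBound`).

Since `m * t ^ (-r) = (∏ j < r, (1 - j / t)) / r!`, the two bounds force `s = 1 / t` and `p = s`.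
So `μ = m * t ^ (-r)`, and `x` is uniform on its support, which has `1 / s = t` elements.

The entropy bound fails for some `x`, and its proof uses what is known about optimal weightings.
It is an instance of Jensen's inequality in the variable `log u`: a function `f` with
`f u ≥ f s + c * log (u / s)` at each `u = x i` satisfies `∑ x i * f (x i) ≥ f s`; the supporting
line comes from a Padé bound for the logarithm (`three_mul_sq_div_le_sub_log`).

* If all weights are at most `1 / (4 * r - 9)`, then
  `(k + 2) * e_(k+2) ≤ (1 - (k + 1) * s) * e_(k+1)` for `k ≤ r - 2`, by Jensen's inequality for
  `f u = (u - s) * Q u`, where `Q (x i)` is the symmetric function of degree `k` of the weights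
  other than `x i` (`selfMean_mul_elemSymm_le`). For `r = 3` the condition is `x i ≤ 1 / r`. For
  `t ≥ 4 * (r - 1) * (r - 2)` it follows from `x i ≤ (r - 1) / t`, which holds since
  `r! * μ ≤ (1 - x i) ^ (r - 1)`.
* For `r = 4` and `r = 5` the bound is proved through power sums (`quartic_selfMean_le`), if `p` is
  a little smaller than `1 / r`. Larger `p` means that `x` is almost uniform on a single edge; then
  that edge carries almost all of `μ`, and `μ` is too small (`mul_sum_sq_lt_of_le_msIndex`) unless
  `m = 1`. The case `m = 1` needs the entropy estimate only.
-/

/-! ### Elementary symmetric functions -/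

/-- The `k`-th elementary symmetric function of the numbers `x i`, `i ∈ A`. -/
def elemSymm {V : Type*} (x : V → ℝ) (k : ℕ) (A : Finset V) : ℝ :=
  ∑ S ∈ A.powersetCard k, ∏ i ∈ S, x i

namespace elemSymm

variable {V : Type*} {x : V → ℝ}

@[simp] theorem zero (A : Finset V) : elemSymm x 0 A = 1 := by
  simp [elemSymm]

theorem succ_empty (k : ℕ) : elemSymm x (k + 1) ∅ = 0 := by
  rw [elemSymm, Finset.powersetCard_eq_empty.2 (by simp), Finset.sum_empty]

theorem nonneg (hx : ∀ i, 0 ≤ x i) (k : ℕ) (A : Finset V) : 0 ≤ elemSymm x k A :=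
  Finset.sum_nonneg fun _ _ => Finset.prod_nonneg fun i _ => hx i

theorem mono (hx : ∀ i, 0 ≤ x i) (k : ℕ) {A B : Finset V} (h : A ⊆ B) :
    elemSymm x k A ≤ elemSymm x k B :=
  Finset.sum_le_sum_of_subset_of_nonneg (Finset.powersetCard_mono h)
    fun _ _ _ => Finset.prod_nonneg fun i _ => hx i

theorem succ_insert [DecidableEq V] {A : Finset V} {a : V} (ha : a ∉ A) (k : ℕ) :
    elemSymm x (k + 1) (insert a A) = elemSymm x (k + 1) A + x a * elemSymm x k A := by
  have hS : ∀ S ∈ A.powersetCard k, a ∉ S := fun S hS h => ha ((Finset.mem_powersetCard.1 hS).1 h)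
  unfold elemSymm
  rw [Finset.powersetCard_succ_insert ha, Finset.sum_union, Finset.sum_image, Finset.mul_sum]
  · congr 1
    exact Finset.sum_congr rfl fun S h => Finset.prod_insert (hS S h)
  · intro S h T h' hST
    rw [← Finset.erase_insert (hS S h), ← Finset.erase_insert (hS T h'), hST]
  · rw [Finset.disjoint_left]
    intro S h h'
    obtain ⟨T, _, rfl⟩ := Finset.mem_image.1 h'
    exact ha ((Finset.mem_powersetCard.1 h).1 (Finset.mem_insert_self _ _))

theorem succ_erase [DecidableEq V] {A : Finset V} {a : V} (ha : a ∈ A) (k : ℕ) :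
    elemSymm x (k + 1) A
      = elemSymm x (k + 1) (A.erase a) + x a * elemSymm x k (A.erase a) := by
  rw [← succ_insert (Finset.notMem_erase a A), Finset.insert_erase ha]

theorem succ_mul_eq_sum [DecidableEq V] (k : ℕ) (A : Finset V) :
    (k + 1 : ℝ) * elemSymm x (k + 1) A = ∑ i ∈ A, x i * elemSymm x k (A.erase i) := by
  induction A using Finset.induction_on generalizing k with
  | empty => simp [succ_empty]
  | insert a B ha ih =>
    have hne : ∀ i ∈ B, a ≠ i := fun i hi h => ha (h ▸ hi)
    rw [Finset.sum_insert ha, Finset.erase_insert ha, succ_insert ha]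
    cases k with
    | zero =>
      have := ih 0
      simp only [zero, CharP.cast_eq_zero, zero_add, one_mul, mul_one] at this ⊢
      rw [this, add_comm]
    | succ k =>
      have h1 : ∀ i ∈ B, x i * elemSymm x (k + 1) ((insert a B).erase i)
          = x i * elemSymm x (k + 1) (B.erase i) + x a * (x i * elemSymm x k (B.erase i)) := by
        intro i hi
        rw [Finset.erase_insert_of_ne (hne i hi),
          succ_insert (fun h => ha (Finset.mem_of_mem_erase h))]
        ring
      rw [Finset.sum_congr rfl h1, Finset.sum_add_distrib, ← Finset.mul_sum, ← ih k, ← ih (k + 1)]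
      push_cast
      ring

theorem factorial_mul_le_pow (hx : ∀ i, 0 ≤ x i) (k : ℕ) (A : Finset V) :
    (k.factorial : ℝ) * elemSymm x k A ≤ (∑ i ∈ A, x i) ^ k := by
  classical
  induction k with
  | zero => simp
  | succ k ih =>
    have h1 : (k + 1 : ℝ) * elemSymm x (k + 1) A ≤ (∑ i ∈ A, x i) * elemSymm x k A := by
      rw [succ_mul_eq_sum, Finset.sum_mul]
      exact Finset.sum_le_sum fun i _ =>
        mul_le_mul_of_nonneg_left (mono hx k (Finset.erase_subset i A)) (hx i)
    have h2 : 0 ≤ ∑ i ∈ A, x i := Finset.sum_nonneg fun i _ => hx i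
    rw [Nat.factorial_succ, pow_succ]
    push_cast
    calc ((k : ℝ) + 1) * k.factorial * elemSymm x (k + 1) A
        = k.factorial * ((k + 1) * elemSymm x (k + 1) A) := by ring
      _ ≤ k.factorial * ((∑ i ∈ A, x i) * elemSymm x k A) := by gcongr
      _ = (∑ i ∈ A, x i) * (k.factorial * elemSymm x k A) := by ring
      _ ≤ (∑ i ∈ A, x i) * (∑ i ∈ A, x i) ^ k := by gcongr
      _ = _ := mul_comm _ _

end elemSymm

/-- The polynomial `∑ j ≤ k, (-u) ^ j * e (k - j)`, defined by Horner's rule. When `e j` is the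
`j`-th elementary symmetric function of `x`, its value at `u = x i` is the `k`-th elementary
symmetric function of `x` without the entry `x i` (`elemSymm_erase_eq_deletedSymm`). -/
def deletedSymm (e : ℕ → ℝ) : ℕ → ℝ → ℝ
  | 0, _ => e 0
  | k + 1, u => e (k + 1) - u * deletedSymm e k u

theorem elemSymm_erase_eq_deletedSymm {V : Type*} [DecidableEq V] (x : V → ℝ) {A : Finset V} {a : V}
    (ha : a ∈ A) (k : ℕ) :
    elemSymm x k (A.erase a) = deletedSymm (fun j => elemSymm x j A) k (x a) := by
  induction k with
  | zero => simp [deletedSymm]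
  | succ k ih =>
    rw [deletedSymm, ← ih, elemSymm.succ_erase ha]
    ring

/-- If `e` grows by a factor of at least `3 * M` at each step, then the functions
`deletedSymm e k` are nonnegative and antitone on `[0, M]`, with small slopes. -/
theorem deletedSymm_bounds {e : ℕ → ℝ} {M : ℝ} (hM : 0 ≤ M) (he : ∀ j, 0 ≤ e j) {K : ℕ}
    (hK : ∀ j < K, 3 * M * e j ≤ e (j + 1)) {k : ℕ} (hk : k ≤ K) :
    (∀ u, 0 ≤ u → u ≤ M → 0 ≤ deletedSymm e k u ∧ deletedSymm e k u ≤ e k) ∧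
    (∀ u v, 0 ≤ u → u ≤ v → v ≤ M → deletedSymm e k v ≤ deletedSymm e k u ∧
      M * (deletedSymm e k u - deletedSymm e k v) ≤ (v - u) * deletedSymm e k u) := by
  induction k with
  | zero =>
    refine ⟨fun u _ _ => ⟨he 0, le_rfl⟩, fun u v _ huv _ => ⟨le_rfl, ?_⟩⟩
    simp only [deletedSymm, sub_self, mul_zero]
    exact mul_nonneg (sub_nonneg.2 huv) (he 0)
  | succ k ih =>
    obtain ⟨h1, h2⟩ := ih (by omega)
    have h3 := hK k (by omega)
    have hlow : ∀ u, 0 ≤ u → u ≤ M → 2 * M * e k ≤ deletedSymm e (k + 1) u := by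
      intro u hu huM
      have := mul_le_mul huM (h1 u hu huM).2 (h1 u hu huM).1 hM
      rw [deletedSymm]
      linarith
    refine ⟨fun u hu huM => ⟨le_trans ?_ (hlow u hu huM), ?_⟩, fun u v hu huv hv => ?_⟩
    · have := he k
      positivity
    · have := mul_nonneg hu (h1 u hu huM).1
      rw [deletedSymm]
      linarith
    · obtain ⟨h4, h5⟩ := h2 u v hu huv hv
      have huM := huv.trans hv
      have h6 := mul_le_mul_of_nonneg_right hv (sub_nonneg.2 h4)
      have h7 : deletedSymm e (k + 1) u - deletedSymm e (k + 1) v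
          = (v - u) * deletedSymm e k u - v * (deletedSymm e k u - deletedSymm e k v) := by
        simp only [deletedSymm]; ring
      refine ⟨by linarith, ?_⟩
      have h8 : deletedSymm e (k + 1) u - deletedSymm e (k + 1) v ≤ (v - u) * e k := by
        have h9 := mul_nonneg (hu.trans huv) (sub_nonneg.2 h4)
        have h10 := mul_le_mul_of_nonneg_left (h1 u hu huM).2 (sub_nonneg.2 huv)
        linarith
      have h11 := mul_le_mul_of_nonneg_left h8 hM
      have h12 := mul_le_mul_of_nonneg_left (hlow u hu huM) (sub_nonneg.2 huv)
      have h13 := mul_nonneg (mul_nonneg hM (sub_nonneg.2 huv)) (he k)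
      linarith

/-- The slope of `deletedSymm e (k + 1)` on `[0, M]` is at most `e k` in absolute value. -/
theorem neg_mul_sq_le_mul_deletedSymm_sub {e : ℕ → ℝ} {M : ℝ} (hM : 0 ≤ M) (he : ∀ j, 0 ≤ e j)
    {k : ℕ} (hK : ∀ j < k, 3 * M * e j ≤ e (j + 1)) {u v : ℝ} (hu : 0 ≤ u) (huM : u ≤ M)
    (hv : 0 ≤ v) (hvM : v ≤ M) :
    -(e k * (u - v) ^ 2)
      ≤ (u - v) * (deletedSymm e (k + 1) u - deletedSymm e (k + 1) v) := by
  wlog huv : u ≤ v generalizing u v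
  · have := this hv hvM hu huM (le_of_not_ge huv)
    linarith
  obtain ⟨h1, h2⟩ := deletedSymm_bounds hM he hK le_rfl
  have h3 := mul_nonneg hv (sub_nonneg.2 (h2 u v hu huv hvM).1)
  have h4 := mul_le_mul_of_nonneg_left (h1 u hu huM).2 (sub_nonneg.2 huv)
  have h8 : deletedSymm e (k + 1) u - deletedSymm e (k + 1) v ≤ (v - u) * e k := by
    simp only [deletedSymm]
    linarith
  have := mul_le_mul_of_nonneg_left h8 (sub_nonneg.2 huv)
  linarith

/-! ### A logarithmic inequality -/

/-- A Padé bound for the logarithm, in homogeneous form. -/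
theorem three_mul_sq_div_le_sub_log {u s : ℝ} (hu : 0 < u) (hs : 0 < s) :
    3 * (u - s) ^ 2 / (4 * u + 2 * s) ≤ u - s - s * (Real.log u - Real.log s) := by
  set g : ℝ → ℝ := fun y => (y ^ 2 + 4 * y - 5) / (4 * y + 2) - Real.log y with hg
  have hd : ∀ y : ℝ, 0 < y → HasDerivAt g (4 * (y - 1) ^ 3 / (y * (4 * y + 2) ^ 2)) y := by
    intro y hy
    have h1 : HasDerivAt (fun y : ℝ => y ^ 2 + 4 * y - 5) (2 * y + 4) y :=
      (((hasDerivAt_pow 2 y).add ((hasDerivAt_id' y).const_mul 4)).sub_const 5).congr_deriv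
        (by norm_num)
    have h2 : HasDerivAt (fun y : ℝ => 4 * y + 2) 4 y :=
      (((hasDerivAt_id' y).const_mul 4).add_const 2).congr_deriv (by norm_num)
    have h3 : (4 * y + 2) ≠ 0 := by positivity
    refine ((h1.div h2 h3).sub (Real.hasDerivAt_log hy.ne')).congr_deriv ?_
    have := hy.ne'
    field_simp
    ring
  have hg1 : g 1 = 0 := by norm_num [hg]
  have hpos : ∀ y : ℝ, 0 < y → 0 ≤ g y := by
    intro y hy
    rcases le_total 1 y with h | h
    · have hm : MonotoneOn g (Set.Icc 1 y) := by
        refine monotoneOn_of_hasDerivWithinAt_nonneg (convex_Icc _ _)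
          (fun z hz => (hd z (by linarith [hz.1])).continuousAt.continuousWithinAt)
          (fun z hz => (hd z ?_).hasDerivWithinAt) fun z hz => ?_
        · rw [interior_Icc] at hz; linarith [hz.1]
        · rw [interior_Icc] at hz
          have h1 : 0 < z := by linarith [hz.1]
          have h2 : 0 ≤ z - 1 := by linarith [hz.1]
          positivity
      rw [← hg1]
      exact hm ⟨le_rfl, h⟩ ⟨h, le_rfl⟩ h
    · have hm : AntitoneOn g (Set.Icc y 1) := by
        refine antitoneOn_of_hasDerivWithinAt_nonpos (convex_Icc _ _)
          (fun z hz => (hd z (by linarith [hz.1])).continuousAt.continuousWithinAt)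
          (fun z hz => (hd z ?_).hasDerivWithinAt) fun z hz => ?_
        · rw [interior_Icc] at hz; linarith [hz.1]
        · rw [interior_Icc] at hz
          have h1 : 0 < z := by linarith [hz.1]
          have h2 : (z - 1) ^ 3 ≤ 0 := by
            have : 0 ≤ (1 - z) ^ 3 := pow_nonneg (by linarith [hz.2]) 3
            linarith [show (z - 1) ^ 3 = -(1 - z) ^ 3 by ring]
          exact div_nonpos_of_nonpos_of_nonneg (by linarith) (by positivity)
      rw [← hg1]
      exact hm ⟨le_rfl, h⟩ ⟨h, le_rfl⟩ h
  have h := mul_nonneg hs.le (hpos (u / s) (by positivity))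
  simp only [hg] at h
  rw [Real.log_div hu.ne' hs.ne'] at h
  have h3 : s * (((u / s) ^ 2 + 4 * (u / s) - 5) / (4 * (u / s) + 2))
      = (u - s) - 3 * (u - s) ^ 2 / (4 * u + 2 * s) := by
    have : 4 * u + 2 * s ≠ 0 := by positivity
    have : 4 * (u / s) + 2 ≠ 0 := by positivity
    field_simp
    ring
  linarith

theorem sub_log_pos {u s : ℝ} (hu : 0 < u) (hs : 0 < s) (hne : u ≠ s) :
    0 < u - s - s * (Real.log u - Real.log s) := by
  refine lt_of_lt_of_le ?_ (three_mul_sq_div_le_sub_log hu hs)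
  have := sub_ne_zero.2 hne
  positivity

/-! ### The weighted geometric mean of a point of the simplex -/

/-- The exponential of minus the Shannon entropy of `x`, that is, the geometric mean of the numbers
`x i` with the weights `x i`. (`Real.log 0 = 0`, so zero entries contribute nothing.) -/
noncomputable def selfMean {V : Type*} [Fintype V] (x : V → ℝ) : ℝ :=
  Real.exp (∑ i, x i * Real.log (x i))

section selfMean

variable {V : Type*} [Fintype V] {x : V → ℝ}

theorem selfMean_pos : 0 < selfMean x := Real.exp_pos _

theorem log_selfMean : Real.log (selfMean x) = ∑ i, x i * Real.log (x i) := Real.log_exp _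

theorem sum_mul_log_sub_log_selfMean (hx : x ∈ stdSimplex ℝ V) :
    ∑ i, x i * (Real.log (x i) - Real.log (selfMean x)) = 0 := by
  simp only [mul_sub, Finset.sum_sub_distrib, ← Finset.sum_mul, hx.2, one_mul, log_selfMean,
    sub_self]

/-- Jensen's inequality at the point `selfMean x`, with a supporting line in the variable `log u`
as hypothesis. -/
theorem le_sum_mul_of_log_le (hx : x ∈ stdSimplex ℝ V) {G : ℝ → ℝ} {b c : ℝ}
    (h : ∀ i, 0 < x i → c * (Real.log (x i) - Real.log (selfMean x)) ≤ G (x i) - b) :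
    b ≤ ∑ i, x i * G (x i) := by
  have h1 : ∀ i, c * (x i * (Real.log (x i) - Real.log (selfMean x)))
      ≤ x i * G (x i) - x i * b := by
    intro i
    rcases (hx.1 i).eq_or_lt with h0 | h0
    · simp [← h0]
    · have := mul_le_mul_of_nonneg_left (h i h0) h0.le
      linarith
  have h2 := Finset.sum_le_sum fun i (_ : i ∈ Finset.univ) => h1 i
  rw [← Finset.mul_sum, sum_mul_log_sub_log_selfMean hx, Finset.sum_sub_distrib, ← Finset.sum_mul,
    hx.2] at h2
  linarith

theorem selfMean_le (hx : x ∈ stdSimplex ℝ V) {M : ℝ} (h : ∀ i, x i ≤ M) : selfMean x ≤ M := by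
  have hM : 0 < M := by
    by_contra hM
    have : ∑ i, x i ≤ 0 := Finset.sum_nonpos fun i _ => (h i).trans (not_lt.1 hM)
    linarith [hx.2]
  rw [← Real.log_le_log_iff selfMean_pos hM, log_selfMean]
  calc ∑ i, x i * Real.log (x i) ≤ ∑ i, x i * Real.log M := by
        refine Finset.sum_le_sum fun i _ => ?_
        rcases (hx.1 i).eq_or_lt with h0 | h0
        · simp [← h0]
        · exact mul_le_mul_of_nonneg_left (Real.log_le_log h0 (h i)) h0.le
    _ = Real.log M := by rw [← Finset.sum_mul, hx.2, one_mul]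

theorem selfMean_le_sum_sq (hx : x ∈ stdSimplex ℝ V) : selfMean x ≤ ∑ i, x i ^ 2 := by
  have := le_sum_mul_of_log_le hx (G := id) (b := selfMean x) (c := selfMean x) fun i h => by
    have h1 := three_mul_sq_div_le_sub_log h (selfMean_pos (x := x))
    have h2 : 0 ≤ 3 * (x i - selfMean x) ^ 2 / (4 * x i + 2 * selfMean x) := by
      have := selfMean_pos (x := x)
      positivity
    simp only [id]
    linarith
  simpa [sq] using this

/-- The equality case of `selfMean_le_sum_sq`: the nonzero entries are equal. -/
theorem eq_selfMean_of_sum_sq_le (hx : x ∈ stdSimplex ℝ V) (h : ∑ i, x i ^ 2 ≤ selfMean x) {i : V}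
    (hi : 0 < x i) : x i = selfMean x := by
  by_contra hne
  set s := selfMean x with hs
  have h1 : ∀ j, 0 ≤ x j * (x j - s - s * (Real.log (x j) - Real.log s)) := by
    intro j
    rcases (hx.1 j).eq_or_lt with h0 | h0
    · simp [← h0]
    · by_cases hj : x j = s
      · simp [hj]
      · exact (mul_pos h0 (sub_log_pos h0 selfMean_pos hj)).le
  have h2 : 0 < ∑ j, x j * (x j - s - s * (Real.log (x j) - Real.log s)) :=
    Finset.sum_pos' (fun j _ => h1 j)
      ⟨i, Finset.mem_univ _, mul_pos hi (sub_log_pos hi selfMean_pos hne)⟩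
  have h3 : ∑ j, x j * (x j - s - s * (Real.log (x j) - Real.log s))
      = ∑ j, x j ^ 2 - s := by
    have h4 : ∀ j, x j * (x j - s - s * (Real.log (x j) - Real.log s))
        = x j ^ 2 - x j * s - s * (x j * (Real.log (x j) - Real.log s)) := fun j => by ring
    simp only [h4, Finset.sum_sub_distrib]
    rw [← Finset.mul_sum, sum_mul_log_sub_log_selfMean hx, ← Finset.sum_mul, hx.2]
    ring
  linarith

/-- If the nonzero entries of a point of the simplex are all equal to `s`, then `s` is the
reciprocal of their number. -/
theorem exists_nat_mul_eq_one (hx : x ∈ stdSimplex ℝ V) {s : ℝ} (h : ∀ i, 0 < x i → x i = s) :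
    ∃ n : ℕ, n * s = 1 := by
  classical
  refine ⟨(Finset.univ.filter fun i => 0 < x i).card, ?_⟩
  rw [← nsmul_eq_mul, ← Finset.sum_const, ← hx.2, Finset.sum_filter]
  refine Finset.sum_congr rfl fun i _ => ?_
  split_ifs with hi
  · exact (h i hi).symm
  · exact le_antisymm (hx.1 i) (not_lt.1 hi)

end selfMean

/-! ### Symmetric functions of small weights -/

section MaclaurinType

variable {V : Type*} [Fintype V] {x : V → ℝ}

theorem elemSymm_one_univ (hx : x ∈ stdSimplex ℝ V) : elemSymm x 1 Finset.univ = 1 := by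
  classical
  have := elemSymm.succ_mul_eq_sum (x := x) 0 Finset.univ
  simpa [hx.2] using this

theorem elemSymm_succ_succ [DecidableEq V] (hx : x ∈ stdSimplex ℝ V) (k : ℕ) :
    (k + 2 : ℝ) * elemSymm x (k + 2) Finset.univ
      = elemSymm x (k + 1) Finset.univ
        - ∑ i, x i * (x i * elemSymm x k (Finset.univ.erase i)) := by
  have h1 := elemSymm.succ_mul_eq_sum (x := x) (k + 1) Finset.univ
  have h2 : ∀ i ∈ Finset.univ, x i * elemSymm x (k + 1) (Finset.univ.erase i)
      = x i * elemSymm x (k + 1) Finset.univ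
        - x i * (x i * elemSymm x k (Finset.univ.erase i)) := by
    intro i hi
    rw [elemSymm.succ_erase hi k]
    ring
  rw [Finset.sum_congr rfl h2, Finset.sum_sub_distrib, ← Finset.sum_mul, hx.2, one_mul] at h1
  rw [← h1]
  push_cast
  ring

theorem elemSymm_mul_le_succ (hx : x ∈ stdSimplex ℝ V) {M : ℝ} (hM : ∀ i, x i ≤ M) (k : ℕ) :
    (1 - k * M) * elemSymm x k Finset.univ ≤ (k + 1) * elemSymm x (k + 1) Finset.univ := by
  classical
  cases k with
  | zero => simp [elemSymm_one_univ hx]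
  | succ k =>
    have h1 := elemSymm_succ_succ hx k
    have h2 : ∑ i, x i * (x i * elemSymm x k (Finset.univ.erase i))
        ≤ M * ∑ i, x i * elemSymm x k (Finset.univ.erase i) := by
      rw [Finset.mul_sum]
      exact Finset.sum_le_sum fun i _ => mul_le_mul_of_nonneg_right (hM i)
        (mul_nonneg (hx.1 i) (elemSymm.nonneg hx.1 _ _))
    rw [← elemSymm.succ_mul_eq_sum] at h2
    push_cast
    linarith

theorem three_mul_elemSymm_le (hx : x ∈ stdSimplex ℝ V) {M : ℝ} (hM : ∀ i, x i ≤ M) {k : ℕ}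
    (hk : (4 * k + 3) * M ≤ 1) :
    3 * M * elemSymm x k Finset.univ ≤ elemSymm x (k + 1) Finset.univ := by
  have h1 := elemSymm_mul_le_succ hx hM k
  have h2 := elemSymm.nonneg hx.1 k Finset.univ
  have h3 : (k + 1) * (3 * M) ≤ 1 - k * M := by linarith
  have h4 := mul_le_mul_of_nonneg_right h3 h2
  have h5 : (0 : ℝ) < k + 1 := by positivity
  refine le_of_mul_le_mul_left ?_ h5
  linarith

/-- The mean of the entries of `x`, weighted by their share in the elementary symmetric function of
degree `k + 1`, is at least `selfMean x`. -/
theorem selfMean_mul_elemSymm_le [DecidableEq V] (hx : x ∈ stdSimplex ℝ V) {M : ℝ}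
    (hM0 : 0 < M) (hM : ∀ i, x i ≤ M) (k : ℕ) (hk : (4 * k - 1) * M ≤ 1) :
    selfMean x * ((k + 1) * elemSymm x (k + 1) Finset.univ)
      ≤ ∑ i, x i * (x i * elemSymm x k (Finset.univ.erase i)) := by
  set s := selfMean x with hs
  have hs0 : 0 < s := selfMean_pos
  have hsM : s ≤ M := selfMean_le hx hM
  set e : ℕ → ℝ := fun j => elemSymm x j Finset.univ with he
  have he0 : ∀ j, 0 ≤ e j := fun j => elemSymm.nonneg hx.1 j _
  suffices h : 0 ≤ ∑ i, x i * ((x i - s) * deletedSymm e k (x i)) by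
    rw [elemSymm.succ_mul_eq_sum, Finset.mul_sum]
    have h1 : ∀ i ∈ Finset.univ, x i * ((x i - s) * deletedSymm e k (x i))
        = x i * (x i * elemSymm x k (Finset.univ.erase i))
          - s * (x i * elemSymm x k (Finset.univ.erase i)) := by
      intro i hi
      rw [elemSymm_erase_eq_deletedSymm x hi]
      ring
    rw [Finset.sum_congr rfl h1, Finset.sum_sub_distrib] at h
    linarith
  cases k with
  | zero =>
    have h1 := selfMean_le_sum_sq hx
    simp only [deletedSymm, he, elemSymm.zero, mul_one, mul_sub, Finset.sum_sub_distrib,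
      ← Finset.sum_mul, hx.2, one_mul]
    simp only [sq] at h1
    linarith
  | succ k =>
    push_cast at hk
    have hK : ∀ j < k + 1, 3 * M * e j ≤ e (j + 1) := by
      intro j hj
      refine three_mul_elemSymm_le hx hM ?_
      have : (j : ℝ) ≤ k := by exact_mod_cast Nat.le_of_lt_succ hj
      nlinarith
    set C := deletedSymm e (k + 1) s with hC
    have hC1 : 2 * M * e k ≤ C := by
      have h1 := ((deletedSymm_bounds hM0.le he0 hK k.le_succ).1 s hs0.le hsM).2
      have h2 := hK k k.lt_succ_self
      have h3 := mul_le_mul_of_nonneg_left h1 hs0.le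
      have h4 := mul_le_mul_of_nonneg_right hsM (he0 k)
      rw [hC, deletedSymm]
      linarith
    have hC0 : 0 ≤ C := le_trans (by have := he0 k; positivity) hC1
    refine le_sum_mul_of_log_le hx (G := fun u => (u - s) * deletedSymm e (k + 1) u) (b := 0)
      (c := s * C) fun i hi => ?_
    have h1 := neg_mul_sq_le_mul_deletedSymm_sub hM0.le he0 (fun j hj => hK j (by omega))
      hi.le (hM i) hs0.le hsM (k := k)
    have h2 := mul_le_mul_of_nonneg_left (three_mul_sq_div_le_sub_log hi hs0) hC0
    have h3 : e k * (x i - s) ^ 2 ≤ C * (3 * (x i - s) ^ 2 / (4 * x i + 2 * s)) := by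
      have h4 : (x i - s) ^ 2 / (2 * M) ≤ 3 * (x i - s) ^ 2 / (4 * x i + 2 * s) := by
        rw [div_le_div_iff₀ (by positivity) (by positivity)]
        have h5 : 4 * x i + 2 * s ≤ 3 * (2 * M) := by linarith [hM i]
        nlinarith [mul_le_mul_of_nonneg_left h5 (sq_nonneg (x i - s))]
      refine le_trans ?_ (mul_le_mul_of_nonneg_left h4 hC0)
      rw [mul_div_assoc', le_div_iff₀ (by positivity)]
      nlinarith [mul_le_mul_of_nonneg_right hC1 (sq_nonneg (x i - s))]
    rw [← hC] at h1
    linarith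

/-- A sharp upper bound for elementary symmetric functions in terms of the entropy, when the
entries are small. It is an equality when the nonzero entries are equal. -/
theorem factorial_mul_elemSymm_le (hx : x ∈ stdSimplex ℝ V) {M : ℝ}
    (hM0 : 0 < M) (hM : ∀ i, x i ≤ M) (k : ℕ) (hk : (4 * k - 1) * M ≤ 1)
    (hs : (k + 1) * selfMean x ≤ 1) :
    ((k + 2).factorial : ℝ) * elemSymm x (k + 2) Finset.univ
      ≤ (1 - ∑ i, x i ^ 2) * ∏ j ∈ Finset.range k, (1 - (j + 2) * selfMean x) := by
  classical
  induction k with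
  | zero =>
    have := elemSymm_succ_succ hx 0
    simp only [elemSymm.zero, zero_add, elemSymm_one_univ hx, mul_one] at this
    simp [Nat.factorial, sq] at this ⊢
    linarith
  | succ k ih =>
    push_cast at hk hs
    have hs0 : 0 < selfMean x := selfMean_pos
    have ih := ih (by linarith) (by linarith)
    have h1 := elemSymm_succ_succ hx (k + 1)
    have h2 := selfMean_mul_elemSymm_le hx hM0 hM (k + 1) (by push_cast; linarith)
    have h3 : (k + 3 : ℝ) * elemSymm x (k + 1 + 2) Finset.univ
        ≤ (1 - (k + 2) * selfMean x) * elemSymm x (k + 2) Finset.univ := by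
      push_cast at h1 h2
      linarith
    rw [Finset.prod_range_succ, Nat.factorial_succ]
    have h4 : 0 ≤ 1 - (k + 2) * selfMean x := by linarith
    have h5 := mul_le_mul_of_nonneg_left h3 (Nat.cast_nonneg (α := ℝ) (k + 2).factorial)
    have h6 := mul_le_mul_of_nonneg_left ih h4
    push_cast at h5 ⊢
    linarith

/-- The estimate through which elementary symmetric functions enter the main argument. The term
with the factor `κ` controls the case of equality. -/
def EntropyBound {V : Type*} [Fintype V] (x : V → ℝ) (r : ℕ) : Prop :=
  ∃ κ : ℝ, 0 < κ ∧ (r.factorial : ℝ) * elemSymm x r Finset.univ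
    + κ * (∑ i, x i ^ 2 - selfMean x) ≤ ∏ j ∈ Finset.range r, (1 - j * selfMean x)

theorem entropyBound_of_le (hx : x ∈ stdSimplex ℝ V) {M : ℝ}
    (hM0 : 0 < M) (hM : ∀ i, x i ≤ M) {r : ℕ} (hr : 2 ≤ r) (hk : (4 * r - 9) * M ≤ 1)
    (hs : (r - 1) * selfMean x < 1) : EntropyBound x r := by
  obtain ⟨k, rfl⟩ := Nat.exists_eq_add_of_le' hr
  push_cast at hk hs
  refine ⟨∏ j ∈ Finset.range k, (1 - (j + 2) * selfMean x), Finset.prod_pos fun j hj => ?_, ?_⟩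
  · have h1 : (j + 1 : ℝ) ≤ k := by exact_mod_cast Finset.mem_range.1 hj
    have h2 : 0 < selfMean x := selfMean_pos
    nlinarith
  · have h1 := factorial_mul_elemSymm_le hx hM0 hM k (by linarith) (by linarith)
    rw [Finset.prod_range_succ', Finset.prod_range_succ']
    push_cast
    simp only [add_assoc, one_add_one_eq_two, zero_mul, sub_zero, mul_one, one_mul]
    linarith

end MaclaurinType

/-! ### Symmetric functions of degrees four and five -/

section PowerSums

variable {V : Type*} [Fintype V] {x : V → ℝ}

/-- The power sums and the elementary symmetric functions of a point of the simplex, in degrees up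
to five. -/
theorem elemSymm_eq_power_sums (hx : x ∈ stdSimplex ℝ V) :
    24 * elemSymm x 4 Finset.univ
      = 1 - 6 * ∑ i, x i ^ 2 + 3 * (∑ i, x i ^ 2) ^ 2 + 8 * ∑ i, x i ^ 3 - 6 * ∑ i, x i ^ 4 ∧
    120 * elemSymm x 5 Finset.univ
      = 1 - 10 * ∑ i, x i ^ 2 + 15 * (∑ i, x i ^ 2) ^ 2 + 20 * ∑ i, x i ^ 3
        - 20 * (∑ i, x i ^ 2) * (∑ i, x i ^ 3) - 30 * ∑ i, x i ^ 4 + 24 * ∑ i, x i ^ 5 := by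
  classical
  set e : ℕ → ℝ := fun j => elemSymm x j Finset.univ with he
  have h : ∀ k : ℕ, (k + 1 : ℝ) * e (k + 1) = ∑ i, x i * deletedSymm e k (x i) := by
    intro k
    rw [he, elemSymm.succ_mul_eq_sum]
    exact Finset.sum_congr rfl fun i hi => by rw [elemSymm_erase_eq_deletedSymm x hi]
  have h0 : e 0 = 1 := elemSymm.zero _
  have h1 : e 1 = 1 := elemSymm_one_univ hx
  have h2 := h 1
  have h3 := h 2
  have h4 := h 3
  have h5 := h 4
  have e2 : ∀ i, x i * deletedSymm e 1 (x i) = x i - x i ^ 2 := fun i => by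
    simp only [deletedSymm, h0, h1]; ring
  have e3 : ∀ i, x i * deletedSymm e 2 (x i) = x i * e 2 - x i ^ 2 + x i ^ 3 := fun i => by
    simp only [deletedSymm, h0, h1]; ring
  have e4 : ∀ i, x i * deletedSymm e 3 (x i) = x i * e 3 - x i ^ 2 * e 2 + x i ^ 3 - x i ^ 4 :=
    fun i => by simp only [deletedSymm, h0, h1]; ring
  have e5 : ∀ i, x i * deletedSymm e 4 (x i)
      = x i * e 4 - x i ^ 2 * e 3 + x i ^ 3 * e 2 - x i ^ 4 + x i ^ 5 :=
    fun i => by simp only [deletedSymm, h0, h1]; ring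
  simp only [e2, Finset.sum_sub_distrib, hx.2] at h2
  simp only [e3, Finset.sum_sub_distrib, Finset.sum_add_distrib, ← Finset.sum_mul, hx.2] at h3
  simp only [e4, Finset.sum_sub_distrib, Finset.sum_add_distrib, ← Finset.sum_mul, hx.2] at h4
  simp only [e5, Finset.sum_sub_distrib, Finset.sum_add_distrib, ← Finset.sum_mul, hx.2] at h5
  norm_num at h2 h3 h4 h5
  change 24 * e 4 = _ ∧ 120 * e 5 = _
  set p2 := ∑ i, x i ^ 2
  set p3 := ∑ i, x i ^ 3
  set p4 := ∑ i, x i ^ 4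
  set p5 := ∑ i, x i ^ 5
  have f2 : e 2 = (1 - p2) / 2 := by linarith
  rw [f2] at h3 h4 h5
  have f3 : e 3 = (1 - 3 * p2 + 2 * p3) / 6 := by linarith
  rw [f3] at h4 h5
  have f4 : e 4 = (1 - 6 * p2 + 3 * p2 ^ 2 + 8 * p3 - 6 * p4) / 24 := by linarith
  rw [f4] at h5
  constructor <;> linarith

/-- Jensen's inequality at the point `selfMean x` for a quartic polynomial without constant term.
The hypothesis makes its graph, in the variable `log u`, lie above its tangent at `selfMean x`. -/
theorem quartic_selfMean_le (hx : x ∈ stdSimplex ℝ V) {c₁ c₂ c₃ c₄ : ℝ}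
    (h : ∀ i, 0 < x i → (4 * x i + 2 * selfMean x) * (c₂ - c₃ * (x i + 2 * selfMean x)
        + c₄ * (x i ^ 2 + 2 * x i * selfMean x + 3 * selfMean x ^ 2))
      ≤ 3 * (c₁ - 2 * c₂ * selfMean x + 3 * c₃ * selfMean x ^ 2 - 4 * c₄ * selfMean x ^ 3))
    (hK : 0 ≤ c₁ - 2 * c₂ * selfMean x + 3 * c₃ * selfMean x ^ 2 - 4 * c₄ * selfMean x ^ 3) :
    c₁ * selfMean x - c₂ * selfMean x ^ 2 + c₃ * selfMean x ^ 3 - c₄ * selfMean x ^ 4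
      ≤ c₁ * ∑ i, x i ^ 2 - c₂ * ∑ i, x i ^ 3 + c₃ * ∑ i, x i ^ 4 - c₄ * ∑ i, x i ^ 5 := by
  set s := selfMean x with hs
  have hs0 : 0 < s := selfMean_pos
  set K := c₁ - 2 * c₂ * s + 3 * c₃ * s ^ 2 - 4 * c₄ * s ^ 3 with hKdef
  have key := le_sum_mul_of_log_le hx
    (G := fun u => c₁ * u - c₂ * u ^ 2 + c₃ * u ^ 3 - c₄ * u ^ 4)
    (b := c₁ * s - c₂ * s ^ 2 + c₃ * s ^ 3 - c₄ * s ^ 4) (c := K * s) fun i hi => by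
      have h1 := mul_le_mul_of_nonneg_left (three_mul_sq_div_le_sub_log hi hs0) hK
      rw [mul_div_assoc'] at h1
      have hd : 0 < 4 * x i + 2 * s := by positivity
      have h2 : (x i - s) ^ 2 * (c₂ - c₃ * (x i + 2 * s)
          + c₄ * (x i ^ 2 + 2 * x i * s + 3 * s ^ 2))
          ≤ K * (3 * (x i - s) ^ 2) / (4 * x i + 2 * s) := by
        rw [le_div_iff₀ hd]
        have := mul_le_mul_of_nonneg_left (h i hi) (sq_nonneg (x i - s))
        linarith
      rw [← hs]
      have h3 : c₁ * x i - c₂ * x i ^ 2 + c₃ * x i ^ 3 - c₄ * x i ^ 4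
          - (c₁ * s - c₂ * s ^ 2 + c₃ * s ^ 3 - c₄ * s ^ 4)
          = K * (x i - s) - (x i - s) ^ 2 * (c₂ - c₃ * (x i + 2 * s)
            + c₄ * (x i ^ 2 + 2 * x i * s + 3 * s ^ 2)) := by
        rw [hKdef]; ring
      linarith
  refine key.trans_eq ?_
  simp only [Finset.mul_sum, ← Finset.sum_sub_distrib, ← Finset.sum_add_distrib]
  exact Finset.sum_congr rfl fun i _ => by ring

/-- The coefficients of `quartic_selfMean_le` are chosen so that its two sides differ, up to the
term with `κ = 1 / 10`, by the difference of `1 - 4! * e_4(x)` and its value at a uniform weighting,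
since `p ^ 2 - s ^ 2 = (p + s) * (p - s)`. -/
theorem entropyBound_four (hx : x ∈ stdSimplex ℝ V) (hM : ∀ i, x i ≤ 1 / 4)
    (hp : ∑ i, x i ^ 2 ≤ 9 / 40) : EntropyBound x 4 := by
  have h1 := (elemSymm_eq_power_sums hx).1
  have hs0 : 0 < selfMean x := selfMean_pos
  have hsp := selfMean_le_sum_sq hx
  set s := selfMean x with hs
  set p := ∑ i, x i ^ 2 with hpdef
  have hss : 0 ≤ (9 / 40 - s) * s := mul_nonneg (by linarith) hs0.le
  have h2 := quartic_selfMean_le hx (c₁ := 6 - 1 / 10 - 3 * (p + s)) (c₂ := 8) (c₃ := 6) (c₄ := 0)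
    (fun i hi => by
      rw [← hs]
      have h3 : 0 ≤ (1 / 4 - x i) * (32 - 24 * x i - 6 - 48 * s - 12 * s) :=
        mul_nonneg (by linarith [hM i]) (by linarith [hM i])
      nlinarith)
    (by rw [← hs]; nlinarith)
  rw [← hs, ← hpdef] at h2
  refine ⟨1 / 10, by norm_num, ?_⟩
  rw [← hs, ← hpdef]
  norm_num [Finset.prod_range_succ, Nat.factorial]
  linarith

/-- The coefficients of `quartic_selfMean_le` come from `p ^ 2 - s ^ 2 = (p + s) * (p - s)` and
`p * q - s ^ 3 = p * (q - s ^ 2) + s ^ 2 * (p - s)`, where `q = ∑ i, x i ^ 3`; here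
`κ = 1 / 100`. -/
theorem entropyBound_five (hx : x ∈ stdSimplex ℝ V) (hM : ∀ i, x i ≤ 1 / 5)
    (hp : ∑ i, x i ^ 2 ≤ 17 / 100) : EntropyBound x 5 := by
  have h1 := (elemSymm_eq_power_sums hx).2
  have hs0 : 0 < selfMean x := selfMean_pos
  have hsp := selfMean_le_sum_sq hx
  set s := selfMean x with hs
  set p := ∑ i, x i ^ 2 with hpdef
  have hs17 : s ≤ 17 / 100 := by linarith
  -- This cubic bounds the slack in the hypothesis of `quartic_selfMean_le` for `p = 17 / 100` and
  -- `u = 1 / 5`. It is decreasing in `s`, and positive at `s = 17 / 100`.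
  have h0 : 0 ≤ 13.072 - 127.4 * s + 373.2 * s ^ 2 - 432 * s ^ 3 := by
    nlinarith [mul_nonneg (sub_nonneg.2 hs17) hs0.le, pow_pos hs0 2,
      mul_nonneg (sub_nonneg.2 hs17) (sq_nonneg s),
      mul_nonneg (sub_nonneg.2 hs17) (sq_nonneg (17 / 100 - s)), sq_nonneg (17 / 100 - s)]
  have h2 := quartic_selfMean_le hx (c₁ := 10 - 1 / 100 - 15 * (p + s) + 20 * s ^ 2)
    (c₂ := 20 - 20 * p) (c₃ := 30) (c₄ := 24)
    (fun i hi => by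
      rw [← hs]
      set u := x i
      have hu : u ≤ 1 / 5 := hM i
      -- The difference of the two sides decreases in `p`, and, at `p = 17 / 100`, in `u`.
      have h3 : 0 ≤ (17 / 100 - p) * (45 - 160 * s - 80 * u) :=
        mul_nonneg (by linarith) (by linarith)
      have h4 : 0 ≤ (1 / 5 - u) * (46.24 - 252 * s + 384 * s ^ 2 - 100.8 * u + 240 * s * u
          + 96 * u ^ 2) := by
        refine mul_nonneg (by linarith) ?_
        nlinarith [mul_nonneg (sub_nonneg.2 hu) (sub_nonneg.2 hs17),
          sq_nonneg (1 / 5 - u), sq_nonneg (17 / 100 - s)]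
      nlinarith)
    (by
      rw [← hs]
      have h3 : 0 ≤ (17 / 100 - p) * (15 - 40 * s) := mul_nonneg (by linarith) (by linarith)
      nlinarith)
  rw [← hs, ← hpdef] at h2
  refine ⟨1 / 100, by norm_num, ?_⟩
  rw [← hs, ← hpdef]
  norm_num [Finset.prod_range_succ, Nat.factorial]
  linarith

end PowerSums

/-! ### Optimal weightings of an `r`-graph -/

namespace RGraph

section Optimal

variable {V : Type*} [Fintype V] {r : ℕ} {G : RGraph V r} {x : V → ℝ}

theorem polyForm_le_elemSymm (hx : ∀ i, 0 ≤ x i) : G.polyForm x ≤ elemSymm x r Finset.univ :=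
  Finset.sum_le_sum_of_subset_of_nonneg
    (fun e he => Finset.mem_powersetCard.2 ⟨Finset.subset_univ _, G.card_eq e he⟩)
    fun _ _ _ => Finset.prod_nonneg fun i _ => hx i

theorem polyForm_smul {V : Type*} {r : ℕ} (G : RGraph V r) (c : ℝ) (x : V → ℝ) :
    G.polyForm (c • x) = c ^ r * G.polyForm x := by
  unfold polyForm
  rw [Finset.mul_sum]
  refine Finset.sum_congr rfl fun e he => ?_
  simp [Finset.prod_mul_distrib, G.card_eq e he]

theorem polyForm_le_msIndex_mul_pow {y : V → ℝ} (hy : ∀ i, 0 ≤ y i) (hs : 0 < ∑ i, y i) :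
    G.polyForm y ≤ G.msIndex * (∑ i, y i) ^ r := by
  set S := ∑ i, y i with hS
  have hz : S⁻¹ • y ∈ stdSimplex ℝ V := by
    refine ⟨fun i => mul_nonneg (inv_nonneg.2 hs.le) (hy i), ?_⟩
    simp only [Pi.smul_apply, smul_eq_mul, ← Finset.mul_sum]
    exact inv_mul_cancel₀ hs.ne'
  have h := G.polyForm_le_msIndex hz
  rw [polyForm_smul, inv_pow] at h
  rwa [inv_mul_le_iff₀ (by positivity), mul_comm] at h

/-- The Lagrange condition at an optimal weighting: the total weight of the edges that contain a
vertex is proportional to the weight of the vertex. -/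
theorem sum_edges_mem_eq [DecidableEq V] (hx : x ∈ stdSimplex ℝ V) (hG : G.polyForm x = G.msIndex)
    (i : V) :
    ∑ e ∈ G.edges with i ∈ e, ∏ j ∈ e, x j = r * G.msIndex * x i := by
  set E := ∑ e ∈ G.edges with i ∈ e, ∏ j ∈ e, x j with hE
  -- Multiply the weight of `i` by `1 + σ`.
  set φ : ℝ → ℝ := fun σ => G.msIndex * (1 + σ * x i) ^ r - (G.msIndex + σ * E) with hφ
  have hmin : IsLocalMin φ 0 := by
    have hnhds : Set.Ioi (-1 : ℝ) ∈ nhds (0 : ℝ) := Ioi_mem_nhds (by norm_num)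
    filter_upwards [hnhds] with σ hσ
    have hσ' : 0 < 1 + σ := by linarith [Set.mem_Ioi.1 hσ]
    have hφ0 : φ 0 = 0 := by simp [hφ]
    set y : V → ℝ := Function.update x i ((1 + σ) * x i) with hy
    have hy0 : ∀ j, 0 ≤ y j := by
      intro j
      by_cases hj : j = i
      · subst hj; simp only [hy, Function.update_self]; exact mul_nonneg hσ'.le (hx.1 j)
      · simp only [hy, Function.update_of_ne hj]; exact hx.1 j
    have hys : ∑ j, y j = 1 + σ * x i := by
      have h1 := Finset.sum_sdiff (f := x) (Finset.subset_univ {i})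
      rw [Finset.sum_singleton, hx.2] at h1
      rw [hy, Finset.sum_update_of_mem (Finset.mem_univ i)]
      linarith
    have hxi1 : x i ≤ 1 := by
      rw [← hx.2]; exact Finset.single_le_sum (fun j _ => hx.1 j) (Finset.mem_univ i)
    have hpos : 0 < 1 + σ * x i := by
      have := mul_nonneg hσ'.le (hx.1 i)
      rcases hxi1.lt_or_eq with h | h
      · linarith
      · rw [h]; linarith
    have hP : G.polyForm y = G.msIndex + σ * E := by
      rw [← hG, hE, Finset.mul_sum, Finset.sum_filter, polyForm, polyForm,
        ← Finset.sum_add_distrib]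
      refine Finset.sum_congr rfl fun e _ => ?_
      split_ifs with hi
      · rw [hy, Finset.prod_update_of_mem hi, ← Finset.mul_prod_erase e x hi,
          Finset.sdiff_singleton_eq_erase]
        ring
      · rw [hy, Finset.prod_update_of_notMem hi, add_zero]
    have := polyForm_le_msIndex_mul_pow (G := G) hy0 (hys ▸ hpos)
    rw [hys, hP] at this
    rw [hφ0]
    simp only [hφ]
    linarith
  have hd : HasDerivAt φ (r * G.msIndex * x i - E) 0 := by
    have h1 : HasDerivAt (fun σ : ℝ => 1 + σ * x i) (x i) 0 :=
      (((hasDerivAt_id' (0 : ℝ)).mul_const (x i)).const_add 1).congr_deriv (by ring)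
    have h2 : HasDerivAt (fun σ : ℝ => G.msIndex + σ * E) E 0 :=
      (((hasDerivAt_id' (0 : ℝ)).mul_const E).const_add _).congr_deriv (by ring)
    refine (((h1.pow r).const_mul G.msIndex).sub h2).congr_deriv ?_
    simp
    ring
  linarith [hmin.hasDerivAt_eq_zero hd]

theorem mul_le_one_of_optimal (hx : x ∈ stdSimplex ℝ V) (hG : G.polyForm x = G.msIndex)
    (hpos : 0 < G.msIndex) (i : V) : r * x i ≤ 1 := by
  classical
  have h1 := sum_edges_mem_eq hx hG i
  have h2 : ∑ e ∈ G.edges with i ∈ e, ∏ j ∈ e, x j ≤ G.polyForm x :=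
    Finset.sum_le_sum_of_subset_of_nonneg (Finset.filter_subset _ _)
      fun _ _ _ => Finset.prod_nonneg fun i _ => hx.1 i
  rw [h1, hG] at h2
  refine le_of_mul_le_mul_left ?_ hpos
  linarith

/-- By the Lagrange condition, summing `f` over the vertices of an edge chosen with probability
proportional to its weight gives `r` times the mean of `f`. -/
theorem sum_edges_mul_sum (hx : x ∈ stdSimplex ℝ V) (hG : G.polyForm x = G.msIndex) (f : V → ℝ) :
    ∑ e ∈ G.edges, (∏ j ∈ e, x j) * ∑ i ∈ e, f i = r * G.msIndex * ∑ i, x i * f i := by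
  classical
  have h1 : ∀ e ∈ G.edges, (∏ j ∈ e, x j) * ∑ i ∈ e, f i
      = ∑ i, if i ∈ e then (∏ j ∈ e, x j) * f i else 0 := by
    intro e _
    rw [Finset.mul_sum, ← Finset.sum_filter, Finset.filter_mem_eq_inter, Finset.univ_inter]
  rw [Finset.sum_congr rfl h1, Finset.sum_comm, Finset.mul_sum]
  refine Finset.sum_congr rfl fun i _ => ?_
  rw [← Finset.sum_filter, ← Finset.sum_mul, sum_edges_mem_eq hx hG]
  ring

/-- The entropy bound: the entropy of a random edge, chosen with probability proportional to its
weight, is at most the logarithm of the number of edges. -/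
theorem msIndex_le_card_mul_selfMean_pow (hx : x ∈ stdSimplex ℝ V)
    (hG : G.polyForm x = G.msIndex) (hpos : 0 < G.msIndex) :
    G.msIndex ≤ G.edges.card * selfMean x ^ r := by
  have hm : 0 < G.edges.card := by
    rw [Finset.card_pos, Finset.nonempty_iff_ne_empty]
    intro h
    rw [← hG, polyForm, h, Finset.sum_empty] at hpos
    exact lt_irrefl _ hpos
  have hm' : (0 : ℝ) < G.edges.card := by exact_mod_cast hm
  set m := (G.edges.card : ℝ)
  set μ := G.msIndex with hμ
  have h1 : ∀ e ∈ G.edges, (∏ j ∈ e, x j) * (Real.log μ - Real.log m)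
      - (∏ j ∈ e, x j) * ∑ i ∈ e, Real.log (x i) ≤ μ / m - ∏ j ∈ e, x j := by
    intro e _
    have h0 : 0 ≤ ∏ j ∈ e, x j := Finset.prod_nonneg fun j _ => hx.1 j
    rcases h0.eq_or_lt with h | h
    · rw [← h]
      simp only [zero_mul, sub_zero]
      positivity
    · have hne : ∀ j ∈ e, x j ≠ 0 := Finset.prod_ne_zero_iff.1 h.ne'
      rw [← Real.log_prod hne]
      have h2 := Real.log_le_sub_one_of_pos (show 0 < μ / (m * ∏ j ∈ e, x j) by positivity)
      rw [Real.log_div hpos.ne' (by positivity), Real.log_mul hm'.ne' h.ne'] at h2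
      have h3 := mul_le_mul_of_nonneg_left h2 h.le
      have h4 : (∏ j ∈ e, x j) * (μ / (m * ∏ j ∈ e, x j) - 1) = μ / m - ∏ j ∈ e, x j := by
        field_simp
      linarith
  have h2 := Finset.sum_le_sum h1
  rw [Finset.sum_sub_distrib, Finset.sum_sub_distrib, ← Finset.sum_mul,
    sum_edges_mul_sum hx hG fun i => Real.log (x i), Finset.sum_const, nsmul_eq_mul,
    ← log_selfMean] at h2
  change G.polyForm x * _ - _ ≤ m * (μ / m) - G.polyForm x at h2
  rw [hG, mul_div_cancel₀ _ hm'.ne', ← hμ, sub_self] at h2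
  have h3 : Real.log μ ≤ Real.log m + r * Real.log (selfMean x) := by
    refine le_of_mul_le_mul_left ?_ hpos
    linarith
  rw [← Real.log_pow, ← Real.log_mul hm'.ne' (pow_pos selfMean_pos r).ne'] at h3
  exact (Real.log_le_log_iff hpos (mul_pos hm' (pow_pos selfMean_pos r))).1 h3

/-- The link of a vertex has at most the weight of all `(r - 1)`-sets of the other vertices. -/
theorem factorial_mul_msIndex_le (hx : x ∈ stdSimplex ℝ V) (hG : G.polyForm x = G.msIndex)
    (hr : r ≠ 0) {i : V} (hi : 0 < x i) :
    (r.factorial : ℝ) * G.msIndex ≤ (1 - x i) ^ (r - 1) := by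
  classical
  obtain ⟨k, rfl⟩ := Nat.exists_eq_add_one_of_ne_zero hr
  have h1 := sum_edges_mem_eq hx hG i
  have h2 : ∑ e ∈ G.edges with i ∈ e, ∏ j ∈ e, x j
      ≤ x i * elemSymm x k (Finset.univ.erase i) := by
    have h3 := elemSymm.succ_erase (x := x) (Finset.mem_univ i) k
    have h4 : elemSymm x (k + 1) Finset.univ
        = (∑ e ∈ Finset.univ.powersetCard (k + 1) with i ∈ e, ∏ j ∈ e, x j)
          + ∑ e ∈ Finset.univ.powersetCard (k + 1) with i ∉ e, ∏ j ∈ e, x j :=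
      (Finset.sum_filter_add_sum_filter_not _ _ _).symm
    have h5 : Finset.filter (fun e => i ∉ e) (Finset.univ.powersetCard (k + 1))
        = (Finset.univ.erase i).powersetCard (k + 1) := by
      ext e
      simp only [Finset.mem_filter, Finset.mem_powersetCard, Finset.subset_univ, true_and,
        Finset.subset_erase]
      tauto
    rw [h5] at h4
    have h6 : ∑ e ∈ G.edges with i ∈ e, ∏ j ∈ e, x j
        ≤ ∑ e ∈ Finset.univ.powersetCard (k + 1) with i ∈ e, ∏ j ∈ e, x j :=
      Finset.sum_le_sum_of_subset_of_nonneg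
        (Finset.filter_subset_filter _ fun e he =>
          Finset.mem_powersetCard.2 ⟨Finset.subset_univ _, G.card_eq e he⟩)
        fun _ _ _ => Finset.prod_nonneg fun i _ => hx.1 i
    change elemSymm x (k + 1) Finset.univ = _ + elemSymm x (k + 1) (Finset.univ.erase i) at h4
    linarith
  rw [h1] at h2
  have h3 : ((k + 1 : ℕ) : ℝ) * G.msIndex ≤ elemSymm x k (Finset.univ.erase i) := by
    refine le_of_mul_le_mul_left ?_ hi
    linarith
  have h4 := elemSymm.factorial_mul_le_pow hx.1 k (Finset.univ.erase i)
  have h5 : ∑ j ∈ Finset.univ.erase i, x j = 1 - x i := by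
    rw [← hx.2, ← Finset.add_sum_erase _ _ (Finset.mem_univ i)]; ring
  rw [h5] at h4
  have h6 := mul_le_mul_of_nonneg_left h3 (Nat.cast_nonneg (α := ℝ) k.factorial)
  rw [Nat.add_sub_cancel, Nat.factorial_succ]
  push_cast at h6 ⊢
  linarith

/-- Some edge carries at least the mean weight of a random edge, which is `r * ∑ i, x i ^ 2`, and
its share in the MS-index is large as every vertex lies in a random edge with probability
`r * x i`. -/
theorem exists_edge_of_optimal (hx : x ∈ stdSimplex ℝ V) (hG : G.polyForm x = G.msIndex)
    (hpos : 0 < G.msIndex) (hr : r ≠ 0) :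
    ∃ β : ℝ, r * ∑ i, x i ^ 2 ≤ β ∧ β ≤ 1 ∧ G.msIndex * (r * β - r + 1) ≤ (β / r) ^ r := by
  classical
  have h1 := sum_edges_mul_sum hx hG x
  have hP : ∑ e ∈ G.edges, ∏ j ∈ e, x j = G.msIndex := hG
  obtain ⟨e, he, hβ⟩ : ∃ e ∈ G.edges, r * ∑ i, x i ^ 2 ≤ ∑ i ∈ e, x i := by
    by_contra! hcon
    have hne : ∃ e ∈ G.edges, 0 < ∏ j ∈ e, x j := by
      by_contra! h
      have := Finset.sum_nonpos h
      linarith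
    obtain ⟨e, he, h0⟩ := hne
    have h2 : ∑ e ∈ G.edges, (∏ j ∈ e, x j) * ∑ i ∈ e, x i
        < ∑ e ∈ G.edges, (∏ j ∈ e, x j) * (r * ∑ i, x i ^ 2) :=
      Finset.sum_lt_sum
        (fun e he => mul_le_mul_of_nonneg_left (hcon e he).le
          (Finset.prod_nonneg fun j _ => hx.1 j))
        ⟨e, he, mul_lt_mul_of_pos_left (hcon e he) h0⟩
    rw [← Finset.sum_mul, hP, h1] at h2
    simp only [← sq] at h2
    linarith
  refine ⟨∑ i ∈ e, x i, hβ, ?_, ?_⟩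
  · rw [← hx.2]
    exact Finset.sum_le_sum_of_subset_of_nonneg (Finset.subset_univ _) fun i _ _ => hx.1 i
  have hr' : (0 : ℝ) < r := by exact_mod_cast Nat.pos_of_ne_zero hr
  have h2 : ∏ j ∈ e, x j ≤ ((∑ i ∈ e, x i) / r) ^ r := by
    have h3 := Real.geom_mean_le_arith_mean e (fun _ => 1) x (fun _ _ => zero_le_one)
      (by simp [G.card_eq e he, Nat.pos_of_ne_zero hr]) fun i _ => hx.1 i
    simp only [Real.rpow_one, one_mul, Finset.sum_const, G.card_eq e he, nsmul_eq_mul,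
      mul_one] at h3
    have h0 : 0 ≤ ∏ j ∈ e, x j := Finset.prod_nonneg fun j _ => hx.1 j
    have h4 := pow_le_pow_left₀ (Real.rpow_nonneg h0 _) h3 r
    rwa [Real.rpow_inv_natCast_pow h0 hr] at h4
  refine le_trans ?_ h2
  -- Every edge other than `e` has at most `r - 1` vertices in `e`.
  have h3 := sum_edges_mul_sum hx hG fun i => if i ∈ e then 1 else 0
  have h4 : ∑ i, x i * (if i ∈ e then (1 : ℝ) else 0) = ∑ i ∈ e, x i := by
    simp
  have h5 : ∑ f ∈ G.edges, (∏ j ∈ f, x j) * ∑ i ∈ f, (if i ∈ e then (1 : ℝ) else 0)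
      ≤ ∑ f ∈ G.edges, ((r - 1) * (∏ j ∈ f, x j) + if f = e then ∏ j ∈ f, x j else 0) := by
    refine Finset.sum_le_sum fun f hf => ?_
    have h0 : 0 ≤ ∏ j ∈ f, x j := Finset.prod_nonneg fun j _ => hx.1 j
    have h6 : ∑ i ∈ f, (if i ∈ e then (1 : ℝ) else 0) = (f ∩ e).card := by
      rw [Finset.sum_ite_mem, Finset.sum_const, nsmul_eq_mul, mul_one]
    rw [h6]
    split_ifs with hfe
    · rw [hfe, Finset.inter_self, G.card_eq e he]
      linarith
    · have h7 : (f ∩ e).card < r := by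
        rw [← G.card_eq f hf]
        refine Finset.card_lt_card ⟨Finset.inter_subset_left, fun h => hfe ?_⟩
        exact Finset.eq_of_subset_of_card_le (fun i hi => (Finset.mem_inter.1 (h hi)).2)
          (by rw [G.card_eq e he, G.card_eq f hf])
      have h8 : ((f ∩ e).card : ℝ) + 1 ≤ r := by exact_mod_cast h7
      have := mul_le_mul_of_nonneg_left h8 h0
      linarith
  rw [h3, h4, Finset.sum_add_distrib, ← Finset.mul_sum, hP, Finset.sum_ite_eq' , if_pos he] at h5
  linarith

end Optimal

end RGraph

/-! ### Generalized binomial coefficients -/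

theorem prod_one_sub_mul_le {r : ℕ} {a b : ℝ} (hab : a ≤ b) (hb : ((r : ℝ) - 1) * b < 1)
    (hb0 : 0 ≤ b) :
    ∏ j ∈ Finset.range r, (1 - j * b) ≤ ∏ j ∈ Finset.range r, (1 - j * a) := by
  refine Finset.prod_le_prod (fun j hj => ?_) fun j _ => ?_
  · have h1 : (j : ℝ) + 1 ≤ r := by exact_mod_cast Finset.mem_range.1 hj
    nlinarith
  · have := mul_le_mul_of_nonneg_left hab (Nat.cast_nonneg (α := ℝ) j)
    linarith

theorem prod_one_sub_mul_lt {r : ℕ} {a b : ℝ} (hr : 2 ≤ r) (hab : a < b)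
    (hb : ((r : ℝ) - 1) * b < 1) (hb0 : 0 ≤ b) :
    ∏ j ∈ Finset.range r, (1 - j * b) < ∏ j ∈ Finset.range r, (1 - j * a) := by
  refine Finset.prod_lt_prod (fun j hj => ?_) (fun j _ => ?_)
    ⟨1, Finset.mem_range.2 (by omega), ?_⟩
  · have h1 : (j : ℝ) + 1 ≤ r := by exact_mod_cast Finset.mem_range.1 hj
    nlinarith
  · have := mul_le_mul_of_nonneg_left hab.le (Nat.cast_nonneg (α := ℝ) j)
    linarith
  · push_cast
    linarith

theorem factorial_mul_ringChoose_mul_zpow {t : ℝ} (ht : t ≠ 0) (r : ℕ) :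
    (r.factorial : ℝ) * (Ring.choose t r * t ^ (-(r : ℤ)))
      = ∏ j ∈ Finset.range r, (1 - j * t⁻¹) := by
  have h1 : (r.factorial : ℝ) ≠ 0 := by positivity
  have h2 : ∀ j ∈ Finset.range r, 1 - (j : ℝ) * t⁻¹ = (t - j) * t⁻¹ := fun j _ => by
    field_simp
  rw [Finset.prod_congr rfl h2, Finset.prod_mul_distrib, Finset.prod_const, Finset.card_range,
    ringChoose_eq_prod_div, zpow_neg, zpow_natCast, inv_pow]
  field_simp

theorem ringChoose_lt_ringChoose {r : ℕ} (hr : r ≠ 0) {a b : ℝ} (ha : (r : ℝ) - 1 < a)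
    (hab : a < b) : Ring.choose a r < Ring.choose b r := by
  rw [ringChoose_eq_prod_div, ringChoose_eq_prod_div]
  refine div_lt_div_of_pos_right ?_ (by positivity)
  refine Finset.prod_lt_prod (fun j hj => ?_) (fun j _ => by linarith)
    ⟨0, Finset.mem_range.2 (Nat.pos_of_ne_zero hr), by linarith⟩
  have h1 : (j : ℝ) + 1 ≤ r := by exact_mod_cast Finset.mem_range.1 hj
  linarith

/-! ### Graphs of large MS-index -/

namespace RGraph

section Optimal

variable {V : Type*} [Fintype V] {r : ℕ} {G : RGraph V r} {x : V → ℝ}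

/-- A large MS-index keeps the optimal weighting away from the uniform weighting of a single
edge. -/
theorem mul_sum_sq_lt_of_le_msIndex (hx : x ∈ stdSimplex ℝ V) (hG : G.polyForm x = G.msIndex)
    (hr : r ≠ 0) {b c : ℝ} (hb0 : 0 ≤ b) (hb1 : b < 1) (hc : c ≤ G.msIndex)
    (hrb : 0 ≤ r * b - r + 1) (hb : (b / r) ^ r < c * (r * b - r + 1))
    (h1 : (1 / (r : ℝ)) ^ r < c) :
    r * ∑ i, x i ^ 2 < b := by
  have hr0 : (0 : ℝ) < r := by exact_mod_cast Nat.pos_of_ne_zero hr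
  have hpos : 0 < G.msIndex := lt_of_lt_of_le (lt_of_le_of_lt (by positivity) h1) hc
  obtain ⟨β, hβ, hβ1, hμ⟩ := exists_edge_of_optimal hx hG hpos hr
  by_contra! hcon
  -- The function `(β / r) ^ r` is convex in `β`, so it suffices to compare at `b` and at `1`.
  set l := (β - b) / (1 - b) with hl
  have hd : 0 < 1 - b := by linarith
  have hl0 : 0 ≤ l := div_nonneg (by linarith) hd.le
  have hl1 : 0 ≤ 1 - l := by
    rw [hl, sub_nonneg, div_le_one hd]
    linarith
  have hβl : β = (1 - l) * b + l := by
    rw [hl]; field_simp; ring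
  have hconv := (convexOn_pow r).2 (show b / r ∈ Set.Ici (0 : ℝ) from div_nonneg hb0 hr0.le)
    (show 1 / (r : ℝ) ∈ Set.Ici (0 : ℝ) from div_nonneg zero_le_one hr0.le) hl1 hl0 (by ring)
  simp only [smul_eq_mul] at hconv
  have h2 : (1 - l) * (b / r) + l * (1 / r) = β / r := by
    rw [hβl]; ring
  rw [h2] at hconv
  have h3 : 0 ≤ r * β - r + 1 := by nlinarith
  have h4 := mul_le_mul_of_nonneg_right hc h3
  have h5 : c * (r * β - r + 1) = (1 - l) * (c * (r * b - r + 1)) + l * c := by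
    rw [hβl]; ring
  have h6 := mul_le_mul_of_nonneg_left hb.le hl1
  have h7 := mul_le_mul_of_nonneg_left h1.le hl0
  rcases hl0.eq_or_lt with h | h
  · rw [← h] at hconv h5
    linarith
  · have := mul_lt_mul_of_pos_left h1 h
    linarith

/-- In the range considered, the elementary symmetric functions of the optimal weighting of a graph
with at least two edges and large MS-index obey the entropy bound. -/
theorem entropyBound_of_optimal (hx : x ∈ stdSimplex ℝ V) (hG : G.polyForm x = G.msIndex)
    (hpos : 0 < G.msIndex) {t : ℝ} (hr : 3 ≤ r) (ht : (r : ℝ) - 1 ≤ t)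
    (h : r ≤ 5 ∨ 4 * ((r : ℝ) - 1) * ((r : ℝ) - 2) ≤ t) (h2 : 2 ≤ Ring.choose t r)
    (hts : t⁻¹ ≤ selfMean x)
    (hμ : ∏ j ∈ Finset.range r, (1 - j * t⁻¹) ≤ (r.factorial : ℝ) * G.msIndex) :
    EntropyBound x r := by
  have hr3 : (3 : ℝ) ≤ r := by exact_mod_cast hr
  have hr0 : (0 : ℝ) < r := by linarith
  have ht0 : 0 < t := by linarith
  have hxr : ∀ i, x i ≤ 1 / r := fun i => by
    rw [le_div_iff₀ hr0]; linarith [mul_le_one_of_optimal hx hG hpos i]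
  have hsr : selfMean x ≤ 1 / r := selfMean_le hx hxr
  have hs0 : 0 < selfMean x := selfMean_pos
  have hsr1 : ((r : ℝ) - 1) * selfMean x < 1 := by
    rw [le_div_iff₀ hr0] at hsr
    linarith
  rcases h with h | h
  · interval_cases r
    · exact entropyBound_of_le hx (by norm_num) hxr (by norm_num) (by norm_num) hsr1
    · norm_num at hxr ht
      -- Already `binom (4.1) 4 < 2`.
      have ht4 : 4.1 ≤ t := by
        by_contra! hcon
        have : t * (t - 1) * (t - 2) * (t - 3) ≤ 4.1 * (4.1 - 1) * (4.1 - 2) * (4.1 - 3) := by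
          gcongr <;> linarith
        rw [ringChoose_eq_prod_div, le_div_iff₀ (by positivity)] at h2
        norm_num [Finset.prod_range_succ, Nat.factorial] at h2 this
        linarith
      have h3 := prod_one_sub_mul_le (r := 4) (inv_anti₀ (by norm_num) ht4) (by norm_num)
        (by norm_num)
      have h4 := h3.trans hμ
      norm_num [Finset.prod_range_succ, Nat.factorial] at h4
      -- `c` is just below `1 / 4!` times the product at `t = 4.1`.
      have h5 := mul_sum_sq_lt_of_le_msIndex hx hG (b := 9 / 10) (c := 432 / 100000)
        (by norm_num) (by norm_num) (by norm_num) (by linarith) (by norm_num) (by norm_num)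
        (by norm_num)
      norm_num at h5
      exact entropyBound_four hx hxr (by linarith)
    · norm_num at hxr ht
      -- Already `binom (5.33) 5 < 2`.
      have ht5 : 5.33 ≤ t := by
        by_contra! hcon
        have : t * (t - 1) * (t - 2) * (t - 3) * (t - 4)
            ≤ 5.33 * (5.33 - 1) * (5.33 - 2) * (5.33 - 3) * (5.33 - 4) := by
          gcongr <;> linarith
        rw [ringChoose_eq_prod_div, le_div_iff₀ (by positivity)] at h2
        norm_num [Finset.prod_range_succ, Nat.factorial] at h2 this
        linarith
      have h3 := prod_one_sub_mul_le (r := 5) (inv_anti₀ (by norm_num) ht5) (by norm_num)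
        (by norm_num)
      have h4 := h3.trans hμ
      norm_num [Finset.prod_range_succ, Nat.factorial] at h4
      -- `c` is just below `1 / 5!` times the product at `t = 5.33`.
      have h5 := mul_sum_sq_lt_of_le_msIndex hx hG (b := 87 / 100) (c := 461 / 1000000)
        (by norm_num) (by norm_num) (by norm_num) (by linarith) (by norm_num) (by norm_num)
        (by norm_num)
      norm_num at h5
      -- The bound `t⁻¹ ≤ ∑ i, x i ^ 2` turns the first estimate into a better one.
      have h6 : t⁻¹ ≤ 174 / 1000 := by
        have := selfMean_le_sum_sq hx
        linarith
      have h7 := (prod_one_sub_mul_le (r := 5) h6 (by norm_num) (by norm_num)).trans hμ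
      norm_num [Finset.prod_range_succ, Nat.factorial] at h7
      have h8 := mul_sum_sq_lt_of_le_msIndex hx hG (b := 85 / 100) (c := 652 / 1000000)
        (by norm_num) (by norm_num) (by norm_num) (by linarith) (by norm_num) (by norm_num)
        (by norm_num)
      norm_num at h8
      exact entropyBound_five hx hxr (by linarith)
  · have ht1 : (r : ℝ) - 1 < t := by nlinarith
    have hM0 : 0 < ((r : ℝ) - 1) / t := div_pos (by linarith) ht0
    refine entropyBound_of_le hx hM0 (fun i => ?_) (by omega) ?_ hsr1
    · -- The link of a vertex of larger weight would be too light.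
      by_contra! hcon
      have hlink := factorial_mul_msIndex_le hx hG (by omega) (hM0.trans hcon)
      have hx1 : x i ≤ 1 := by
        rw [← hx.2]; exact Finset.single_le_sum (fun j _ => hx.1 j) (Finset.mem_univ i)
      obtain ⟨k, rfl⟩ := Nat.exists_eq_add_one_of_ne_zero (show r ≠ 0 by omega)
      have hlow : (1 - ((k + 1 : ℕ) - 1 : ℝ) / t) ^ k
          ≤ ∏ j ∈ Finset.range (k + 1), (1 - j * t⁻¹) := by
        rw [Finset.prod_range_succ', Nat.cast_zero, zero_mul, sub_zero, mul_one]
        nth_rewrite 2 [← Finset.card_range k]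
        rw [← Finset.prod_const]
        refine Finset.prod_le_prod (fun j _ => ?_) fun j hj => ?_
        · rw [sub_nonneg, div_le_one ht0]; exact ht1.le
        · have h3 : ((j + 1 : ℕ) : ℝ) ≤ k := by exact_mod_cast Finset.mem_range.1 hj
          have h4 := mul_le_mul_of_nonneg_right h3 (inv_nonneg.2 ht0.le)
          rw [div_eq_mul_inv]
          push_cast at h4 ⊢
          linarith
      rw [Nat.add_sub_cancel] at hlink
      have hlt : (1 - x i) ^ k < (1 - ((k + 1 : ℕ) - 1 : ℝ) / t) ^ k :=
        pow_lt_pow_left₀ (by linarith) (by linarith) (by omega)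
      linarith
    · rw [mul_div_assoc', div_le_one ht0]
      nlinarith

/-- An `r`-graph whose MS-index reaches `binom t r * t ^ (-r)` does not exceed this value, and then
`t` is an integer. -/
theorem eq_and_exists_nat_of_le_msIndex {m : ℕ} {t : ℝ} (hr : 3 ≤ r) (ht : (r : ℝ) - 1 ≤ t)
    (hm : (m : ℝ) = Ring.choose t r) (h : r ≤ 5 ∨ 4 * ((r : ℝ) - 1) * ((r : ℝ) - 2) ≤ t)
    (hcard : G.edges.card = m) (hm0 : m ≠ 0) (hle : (m : ℝ) * t ^ (-(r : ℤ)) ≤ G.msIndex) :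
    G.msIndex = (m : ℝ) * t ^ (-(r : ℤ)) ∧ ∃ k : ℕ, t = k := by
  have hr3 : (3 : ℝ) ≤ r := by exact_mod_cast hr
  have hr0 : (0 : ℝ) < r := by linarith
  have ht0 : 0 < t := by linarith
  have hm0' : (0 : ℝ) < m := by exact_mod_cast Nat.pos_of_ne_zero hm0
  have hpos : 0 < G.msIndex := lt_of_lt_of_le (by positivity) hle
  have : Nonempty V := by
    obtain ⟨e, he⟩ := Finset.card_pos.1 (hcard ▸ Nat.pos_of_ne_zero hm0)
    obtain ⟨v, _⟩ := Finset.card_pos.1 (show 0 < e.card by rw [G.card_eq e he]; omega)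
    exact ⟨v⟩
  obtain ⟨x, hx, hG⟩ := G.isGreatest_msIndex.1
  have hs0 : 0 < selfMean x := selfMean_pos
  have hsr : selfMean x ≤ 1 / r := selfMean_le hx fun i => by
    rw [le_div_iff₀ hr0]; linarith [mul_le_one_of_optimal hx hG hpos i]
  have hent := msIndex_le_card_mul_selfMean_pow hx hG hpos
  rw [hcard] at hent
  have hts : t⁻¹ ≤ selfMean x := by
    have h1 := le_of_mul_le_mul_left (hle.trans hent) hm0'
    rw [zpow_neg, zpow_natCast, ← inv_pow] at h1
    exact le_of_pow_le_pow_left₀ (by omega) hs0.le h1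
  -- It suffices to show that `t` is an integer and that `selfMean x ≤ t⁻¹`.
  suffices hmain : selfMean x ≤ t⁻¹ ∧ ∃ k : ℕ, t = k by
    refine ⟨le_antisymm ?_ hle, hmain.2⟩
    refine hent.trans (mul_le_mul_of_nonneg_left ?_ hm0'.le)
    rw [zpow_neg, zpow_natCast, ← inv_pow]
    exact pow_le_pow_left₀ hs0.le hmain.1 r
  by_cases hm1 : m = 1
  · have htr : (r : ℝ) ≤ t := by
      have h1 := hts.trans hsr
      rwa [← one_div, one_div_le_one_div ht0 hr0] at h1
    have htr' : t = r := by
      refine le_antisymm (le_of_not_gt fun hlt => ?_) htr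
      have h1 := ringChoose_lt_ringChoose (r := r) (by omega) (by linarith) hlt
      rw [← hm, Ring.choose_natCast, hm1, Nat.choose_self] at h1
      exact lt_irrefl _ h1
    exact ⟨by rw [htr', ← one_div]; exact hsr, r, htr'⟩
  have h2 : 2 ≤ Ring.choose t r := by
    rw [← hm]; exact_mod_cast (by omega : 2 ≤ m)
  have hprod := factorial_mul_ringChoose_mul_zpow ht0.ne' r
  rw [← hm] at hprod
  have hμ : ∏ j ∈ Finset.range r, (1 - j * t⁻¹) ≤ (r.factorial : ℝ) * G.msIndex := by
    rw [← hprod]; gcongr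
  obtain ⟨κ, hκ, hE⟩ := entropyBound_of_optimal hx hG hpos hr ht h h2 hts hμ
  have hsr1 : ((r : ℝ) - 1) * selfMean x < 1 := by
    rw [le_div_iff₀ hr0] at hsr
    linarith
  have hP := polyForm_le_elemSymm (G := G) hx.1
  rw [hG] at hP
  have hP' := mul_le_mul_of_nonneg_left hP (Nat.cast_nonneg (α := ℝ) r.factorial)
  have hps := mul_nonneg hκ.le (sub_nonneg.2 (selfMean_le_sum_sq hx))
  have hst : selfMean x ≤ t⁻¹ := by
    by_contra! hlt
    have := prod_one_sub_mul_lt (by omega) hlt hsr1 hs0.le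
    linarith
  have hst' : selfMean x = t⁻¹ := le_antisymm hst hts
  rw [hst'] at hE
  have hsq : ∑ i, x i ^ 2 ≤ selfMean x := by
    rw [hst']
    have h3 : κ * (∑ i, x i ^ 2 - t⁻¹) ≤ κ * 0 := by linarith
    linarith [le_of_mul_le_mul_left h3 hκ]
  obtain ⟨n, hn⟩ := exists_nat_mul_eq_one hx fun i hi => eq_selfMean_of_sum_sq_le hx hsq hi
  refine ⟨hst, n, ?_⟩
  rw [hst'] at hn
  field_simp at hn
  exact hn.symm

end Optimal

/-! ### The extremal value -/

theorem msIndex_eq_zero_of_card_edges_eq_zero {V : Type*} [Fintype V] {r : ℕ} {G : RGraph V r}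
    (h : G.edges.card = 0) : G.msIndex = 0 := by
  refine le_antisymm (Real.sSup_le ?_ le_rfl) G.msIndex_nonneg
  rintro _ ⟨x, _, rfl⟩
  rw [polyForm, Finset.card_eq_zero.1 h, Finset.sum_empty]

theorem card_edges_complete (k r : ℕ) : (complete (Fin k) r).edges.card = k.choose r := by
  simp [complete]

/-- The uniform weighting of the complete `r`-graph. -/
theorem choose_mul_zpow_le_msIndex_complete {k : ℕ} (hk : k ≠ 0) (r : ℕ) :
    (k.choose r : ℝ) * (k : ℝ) ^ (-(r : ℤ)) ≤ (complete (Fin k) r).msIndex := by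
  have hk' : (k : ℝ) ≠ 0 := by exact_mod_cast hk
  have hx : (fun _ => (k : ℝ)⁻¹) ∈ stdSimplex ℝ (Fin k) := by
    refine ⟨fun _ => by positivity, ?_⟩
    simp [hk']
  refine le_of_eq_of_le ?_ (polyForm_le_msIndex _ hx)
  have h1 : ∀ e ∈ (complete (Fin k) r).edges, ∏ _i ∈ e, (k : ℝ)⁻¹ = (k : ℝ)⁻¹ ^ r := by
    intro e he
    rw [Finset.prod_const, (complete (Fin k) r).card_eq e he]
  rw [polyForm, Finset.sum_congr rfl h1, Finset.sum_const, card_edges_complete, nsmul_eq_mul,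
    zpow_neg, zpow_natCast, inv_pow]

theorem msIndex_le_of_ringChoose {r m : ℕ} {t : ℝ} (hr : 3 ≤ r) (ht : (r : ℝ) - 1 ≤ t)
    (hm : (m : ℝ) = Ring.choose t r) (h : r ≤ 5 ∨ 4 * ((r : ℝ) - 1) * ((r : ℝ) - 2) ≤ t)
    {V : Type*} [Fintype V] {G : RGraph V r} (hcard : G.edges.card = m) :
    G.msIndex ≤ (m : ℝ) * t ^ (-(r : ℤ)) ∧
      (G.msIndex = (m : ℝ) * t ^ (-(r : ℤ)) → ∃ k : ℕ, t = k) := by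
  have hr3 : (3 : ℝ) ≤ r := by exact_mod_cast hr
  rcases eq_or_ne m 0 with hm0 | hm0
  · refine ⟨by simp [msIndex_eq_zero_of_card_edges_eq_zero (hcard.trans hm0), hm0], fun _ => ?_⟩
    -- The condition `r - 1 ≤ t` leaves only the root `t = r - 1` of the binomial coefficient.
    refine ⟨r - 1, ?_⟩
    rw [Nat.cast_sub (by omega), Nat.cast_one]
    refine le_antisymm (le_of_not_gt fun hlt => ?_) ht
    rw [hm0, ringChoose_eq_prod_div, Nat.cast_zero] at hm
    refine absurd hm (div_pos (Finset.prod_pos fun j hj => ?_) (by positivity)).ne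
    have h1 : (j : ℝ) + 1 ≤ r := by exact_mod_cast Finset.mem_range.1 hj
    linarith
  · refine ⟨le_of_not_gt fun hlt => ?_, fun heq => ?_⟩
    · exact hlt.ne' (eq_and_exists_nat_of_le_msIndex hr ht hm h hcard hm0 hlt.le).1
    · exact (eq_and_exists_nat_of_le_msIndex hr ht hm h hcard hm0 heq.ge).2

end RGraph

theorem mainTheorem1 (r m : ℕ) (t : ℝ) (hr : 3 ≤ r) (ht : (r : ℝ) - 1 ≤ t)
    (hm : (m : ℝ) = Ring.choose t r)
    (h : r ≤ 5 ∨ 4 * ((r : ℝ) - 1) * ((r : ℝ) - 2) ≤ t) :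
    (∀ (V : Type*) [Fintype V] (G : RGraph V r), G.edges.card = m →
      G.msIndex ≤ (m : ℝ) * t ^ (-(r : ℤ)) ∧
      (G.msIndex = (m : ℝ) * t ^ (-(r : ℤ)) → ∃ k : ℕ, t = k)) ∧
    (RGraph.maxMSIndex r m = (m : ℝ) * t ^ (-(r : ℤ)) ↔ ∃ k : ℕ, t = k) ∧
    (∀ k : ℕ, t = k →
      (RGraph.complete (Fin k) r).edges.card = m ∧
      (RGraph.complete (Fin k) r).msIndex = RGraph.maxMSIndex r m) := by
  have hr3 : (3 : ℝ) ≤ r := by exact_mod_cast hr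
  obtain ⟨⟨n, G, hG, hGmax⟩, hmax⟩ := RGraph.isGreatest_maxMSIndex (show 1 ≤ r by omega) m
  have hcomplete : ∀ k : ℕ, t = k → (RGraph.complete (Fin k) r).edges.card = m ∧
      (m : ℝ) * t ^ (-(r : ℤ)) ≤ (RGraph.complete (Fin k) r).msIndex := by
    intro k hk
    have hkm : k.choose r = m := by
      rw [hk, Ring.choose_natCast] at hm
      exact_mod_cast hm.symm
    have hk0 : k ≠ 0 := by
      rintro rfl
      rw [Nat.cast_zero] at hk
      linarith
    refine ⟨by rw [RGraph.card_edges_complete, hkm], ?_⟩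
    rw [hk, ← hkm]
    exact RGraph.choose_mul_zpow_le_msIndex_complete hk0 r
  have hle : RGraph.maxMSIndex r m ≤ (m : ℝ) * t ^ (-(r : ℤ)) := by
    rw [← hGmax]
    exact (RGraph.msIndex_le_of_ringChoose hr ht hm h hG).1
  refine ⟨fun V _ G hG => RGraph.msIndex_le_of_ringChoose hr ht hm h hG, ⟨fun heq => ?_, ?_⟩, ?_⟩
  · exact (RGraph.msIndex_le_of_ringChoose hr ht hm h hG).2 (hGmax.trans heq)
  · rintro ⟨k, hk⟩
    obtain ⟨hc, hge⟩ := hcomplete k hk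
    exact le_antisymm hle (hge.trans (hmax ⟨k, _, hc, rfl⟩))
  · intro k hk
    obtain ⟨hc, hge⟩ := hcomplete k hk
    exact ⟨hc, le_antisymm (hmax ⟨k, _, hc, rfl⟩) (hle.trans hge)⟩
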